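/- Proposition 5.1. Let $p>1$ be real, let $m\ge1$ be an integer and let $A_1,\dots,A_m,\gamma_1,\dots,\gamma_m\in\mathbb R$ satisfy $A_h^2+\gamma_h\ge0$ for all $h=1,\dots,m$. For $k\ge 0$ let $W^{k,p}(\mathbb R)$ be the Sobolev space of real-valued $g\in L^p(\mathbb R)$ whose weak derivatives up to order $k$ lie in $L^p(\mathbb R)$, with standard norm $$\|g\|_{W^{k,p}}=\Big(\int_{\mathbb R}|g^{(k)}|^p\,ds+\int_{\mathbb R}|g|^p\,ds\Big)^{1/p}.$$ Put $L_hg=g''-2A_hg'-\gamma_hg$ (derivatives in the weak sense) and $\mathbb L=L_1\circ\cdots\circ L_m$, a differential operator of order $2m$. Then $$\inf_{\substack{g\in W^{2m,p}(\mathbb R)\\ g\ne0}}\frac{\int_{\mathbb R}|\mathbb Lg|^p\,ds}{\int_{\mathbb R}|g|^p\,ds}=\prod_{h=1}^m|\gamma_h|^p .$$ Moreover, if $\gamma_h\ne0$ for all $h=1,\dots,m$, then $g\mapsto\|\mathbb Lg\|_p=\big(\int_{\mathbb R}|\mathbb Lg|^p\,ds\big)^{1/p}$ is a norm on $W^{2m,p}(\mathbb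 R)$ which is equivalent to $\|\cdot\|_{W^{2m,p}}$: there are constants $c,C>0$ such that $c\,\|g\|_{W^{2m,p}}\le\|\mathbb Lg\|_p\le C\,\|g\|_{W^{2m,p}}$ for all $g\in W^{2m,p}(\mathbb R)$. -/

import Mathlib

open MeasureTheory

open scoped ContDiff

noncomputable section

namespace SobolevLine

/-- The real exponent `p > 1`, read in `ℝ≥0∞`, is at least `1`. -/
instance fact_one_le_ofReal (p : ℝ) [hp : Fact (1 < p)] : Fact (1 ≤ ENNReal.ofReal p) :=
  ⟨ENNReal.one_le_ofReal.2 hp.out.le⟩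

/-- The Lebesgue space `L^p(ℝ)` of real-valued functions on the line (classes modulo equality
almost everywhere). -/
abbrev LpLine (p : ℝ) : Type := Lp ℝ (ENNReal.ofReal p) (volume : Measure ℝ)

/-- `f` is the weak derivative of order `j` of `g`:
`∫ g φ⁽ʲ⁾ = (-1)ʲ ∫ f φ` for all test functions `φ ∈ C_c^∞(ℝ)`. -/
def HasWeakDeriv {p : ℝ} (j : ℕ) (g f : LpLine p) : Prop :=
  ∀ φ : ℝ → ℝ, ContDiff ℝ ∞ φ → HasCompactSupport φ →
    ∫ s, g s * iteratedDeriv j φ s = (-1) ^ j * ∫ s, f s * φ s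

section

set_option linter.unusedSectionVars false

variable {p : ℝ} [Fact (1 < p)]

theorem contDiff_iteratedDeriv {φ : ℝ → ℝ} (hφ : ContDiff ℝ ∞ φ) (j : ℕ) :
    ContDiff ℝ ∞ (iteratedDeriv j φ) := by
  rw [iteratedDeriv_eq_iterate]
  exact ContDiff.iterate_deriv j hφ

theorem hasCompactSupport_iteratedDeriv {φ : ℝ → ℝ} (hc : HasCompactSupport φ) (j : ℕ) :
    HasCompactSupport (iteratedDeriv j φ) := by
  induction j with
  | zero => simpa using hc
  | succ j ih => rw [iteratedDeriv_succ]; exact ih.deriv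

theorem locallyIntegrable_coe (g : LpLine p) : LocallyIntegrable g volume :=
  (Lp.memLp g).locallyIntegrable Fact.out

theorem integrable_mul_test (g : LpLine p) {φ : ℝ → ℝ} (hφ : ContDiff ℝ ∞ φ)
    (hc : HasCompactSupport φ) : Integrable (fun s => g s * φ s) volume := by
  have := (locallyIntegrable_coe g).integrable_smul_left_of_hasCompactSupport hφ.continuous hc
  simpa [mul_comm] using this

/-- Weak derivatives are unique. -/
theorem HasWeakDeriv.unique {j : ℕ} {g f₁ f₂ : LpLine p} (h₁ : HasWeakDeriv j g f₁)
    (h₂ : HasWeakDeriv j g f₂) : f₁ = f₂ := by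
  apply Lp.ext
  refine ae_eq_of_integral_contDiff_smul_eq (locallyIntegrable_coe f₁)
    (locallyIntegrable_coe f₂) fun φ hφ hc => ?_
  have h := (h₁ φ hφ hc).symm.trans (h₂ φ hφ hc)
  have h' := mul_left_cancel₀ (pow_ne_zero j (by norm_num : (-1 : ℝ) ≠ 0)) h
  simpa [mul_comm] using h'

theorem hasWeakDeriv_zero (g : LpLine p) : HasWeakDeriv 0 g g := fun φ _ _ => by simp

theorem HasWeakDeriv.add {j : ℕ} {g₁ g₂ f₁ f₂ : LpLine p} (h₁ : HasWeakDeriv j g₁ f₁)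
    (h₂ : HasWeakDeriv j g₂ f₂) : HasWeakDeriv j (g₁ + g₂) (f₁ + f₂) := by
  intro φ hφ hc
  have hφ' := contDiff_iteratedDeriv hφ j
  have hc' := hasCompactSupport_iteratedDeriv hc j
  have e₁ : ∫ s, (g₁ + g₂) s * iteratedDeriv j φ s
      = ∫ s, (g₁ s * iteratedDeriv j φ s + g₂ s * iteratedDeriv j φ s) := by
    refine integral_congr_ae ?_
    filter_upwards [Lp.coeFn_add g₁ g₂] with s hs
    rw [hs, Pi.add_apply, add_mul]
  have e₂ : ∫ s, (f₁ + f₂) s * φ s = ∫ s, (f₁ s * φ s + f₂ s * φ s) := by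
    refine integral_congr_ae ?_
    filter_upwards [Lp.coeFn_add f₁ f₂] with s hs
    rw [hs, Pi.add_apply, add_mul]
  rw [e₁, e₂, integral_add (integrable_mul_test _ hφ' hc') (integrable_mul_test _ hφ' hc'),
    integral_add (integrable_mul_test _ hφ hc) (integrable_mul_test _ hφ hc),
    h₁ φ hφ hc, h₂ φ hφ hc, mul_add]

theorem HasWeakDeriv.smul {j : ℕ} (c : ℝ) {g f : LpLine p} (h : HasWeakDeriv j g f) :
    HasWeakDeriv j (c • g) (c • f) := by
  intro φ hφ hc
  have e₁ : ∫ s, (c • g) s * iteratedDeriv j φ s = ∫ s, c * (g s * iteratedDeriv j φ s) := by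
    refine integral_congr_ae ?_
    filter_upwards [Lp.coeFn_smul c g] with s hs
    rw [hs, Pi.smul_apply, smul_eq_mul, mul_assoc]
  have e₂ : ∫ s, (c • f) s * φ s = ∫ s, c * (f s * φ s) := by
    refine integral_congr_ae ?_
    filter_upwards [Lp.coeFn_smul c f] with s hs
    rw [hs, Pi.smul_apply, smul_eq_mul, mul_assoc]
  rw [e₁, e₂, integral_const_mul, integral_const_mul, h φ hφ hc]
  ring

theorem HasWeakDeriv.of_succ {j : ℕ} {g f h : LpLine p} (h₁ : HasWeakDeriv 1 g f)
    (h₂ : HasWeakDeriv (j + 1) g h) : HasWeakDeriv j f h := by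
  intro φ hφ hc
  have a := h₁ _ (contDiff_iteratedDeriv hφ j) (hasCompactSupport_iteratedDeriv hc j)
  rw [iteratedDeriv_one, ← iteratedDeriv_succ, h₂ φ hφ hc] at a
  rw [pow_succ, pow_one] at a
  linarith

variable (p)

/-- The Sobolev space `W^{k,p}(ℝ)`: the functions in `L^p(ℝ)` all of whose weak derivatives up to
order `k` exist and lie in `L^p(ℝ)`. -/
def W (k : ℕ) : Submodule ℝ (LpLine p) where
  carrier := {g | ∀ j ≤ k, ∃ f : LpLine p, HasWeakDeriv j g f}
  add_mem' := by
    intro g₁ g₂ h₁ h₂ j hj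
    obtain ⟨f₁, hf₁⟩ := h₁ j hj
    obtain ⟨f₂, hf₂⟩ := h₂ j hj
    exact ⟨f₁ + f₂, hf₁.add hf₂⟩
  zero_mem' := by
    intro j _
    refine ⟨0, ?_⟩
    intro φ hφ hc
    have z : ∀ ψ : ℝ → ℝ, ∫ s, (0 : LpLine p) s * ψ s = 0 := fun ψ => by
      rw [← integral_zero ℝ ℝ (μ := volume)]
      refine integral_congr_ae ?_
      filter_upwards [Lp.coeFn_zero ℝ (ENNReal.ofReal p) (volume : Measure ℝ)] with s hs
      rw [hs, Pi.zero_apply, zero_mul]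
    rw [z, z, mul_zero]
  smul_mem' := by
    intro c g h j hj
    obtain ⟨f, hf⟩ := h j hj
    exact ⟨c • f, hf.smul c⟩

variable {p}

/-- The weak derivative `g⁽ʲ⁾ ∈ L^p(ℝ)`, for `g ∈ W^{k,p}(ℝ)` and `j ≤ k`. -/
def weakDeriv {k : ℕ} (j : ℕ) (hj : j ≤ k) (g : W p k) : LpLine p :=
  (g.2 j hj).choose

theorem hasWeakDeriv_weakDeriv {k : ℕ} (j : ℕ) (hj : j ≤ k) (g : W p k) :
    HasWeakDeriv j (g : LpLine p) (weakDeriv j hj g) :=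
  (g.2 j hj).choose_spec

/-- The derivative `g ↦ g'`, as a linear map `W^{k+1,p}(ℝ) → W^{k,p}(ℝ)`. -/
def D (k : ℕ) : W p (k + 1) →ₗ[ℝ] W p k where
  toFun g := ⟨weakDeriv 1 (Nat.le_add_left 1 k) g, fun j hj =>
    ⟨weakDeriv (j + 1) (Nat.succ_le_succ hj) g,
      (hasWeakDeriv_weakDeriv _ _ g).of_succ (hasWeakDeriv_weakDeriv _ _ g)⟩⟩
  map_add' g₁ g₂ := Subtype.ext <|
    (hasWeakDeriv_weakDeriv 1 (Nat.le_add_left 1 k) (g₁ + g₂)).unique <|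
      (hasWeakDeriv_weakDeriv 1 (Nat.le_add_left 1 k) g₁).add
        (hasWeakDeriv_weakDeriv 1 (Nat.le_add_left 1 k) g₂)
  map_smul' c g := Subtype.ext <|
    (hasWeakDeriv_weakDeriv 1 (Nat.le_add_left 1 k) (c • g)).unique <|
      (hasWeakDeriv_weakDeriv 1 (Nat.le_add_left 1 k) g).smul c

/-- The inclusion `W^{k+1,p}(ℝ) → W^{k,p}(ℝ)`. -/
def incl (k : ℕ) : W p (k + 1) →ₗ[ℝ] W p k :=
  Submodule.inclusion fun _ hg j hj => hg j (Nat.le_succ_of_le hj)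

/-- The second order operator `g ↦ g'' - 2 A g' - γ g`, as a linear map
`W^{k+2,p}(ℝ) → W^{k,p}(ℝ)`. -/
def L (A γ : ℝ) (k : ℕ) : W p (k + 2) →ₗ[ℝ] W p k :=
  (D (p := p) k ∘ₗ D (k + 1)) - (2 * A) • (incl (p := p) k ∘ₗ D (k + 1)) -
    γ • (incl (p := p) k ∘ₗ incl (k + 1))

/-- The operator `L₁ ∘ ⋯ ∘ L_m` of order `2m`, with `L_h g = g'' - 2 A_h g' - γ_h g`,
from `W^{2m,p}(ℝ)` to `W^{0,p}(ℝ) = L^p(ℝ)`. The operator with the last index acts first. -/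
def LL : (m : ℕ) → (A γ : Fin m → ℝ) → (W p (2 * m) →ₗ[ℝ] W p 0)
  | 0, _, _ => LinearMap.id
  | m + 1, A, γ =>
    LL m (fun h => A h.castSucc) (fun h => γ h.castSucc) ∘ₗ
      L (A (Fin.last m)) (γ (Fin.last m)) (2 * m)

/-- The standard norm `(∫ |g⁽ᵏ⁾|^p + ∫ |g|^p)^{1/p}` of `W^{k,p}(ℝ)`. -/
def sobolevNorm {k : ℕ} (g : W p k) : ℝ :=
  ((∫ s, |weakDeriv k le_rfl g s| ^ p) + ∫ s, |(g : LpLine p) s| ^ p) ^ (1 / p)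

end

end SobolevLine

end

/-! Since `A ^ 2 + γ ≥ 0`, each `L` splits as `(D - a)(D - b)` with `a`, `b` real and `a * b = -γ`.
The core estimate is `‖g' - c g‖ ≥ |c| ‖g‖` (`HasWeakDeriv.abs_mul_norm_le`): differentiation
generates the isometric group of translations, so real shifts of it are bounded below. Multiplying
over the factors yields the lower bound `∏ |γ_h|`. It is sharp because replacing `φ` by `φ (ε s)`
makes every derivative gain a factor `ε`, so that the operator tends to multiplication by `∏ (-γ_h)`
(`exists_norm_LL_sub_le`). For the equivalence, the factors commute with `D`, so the core estimate
holds at every order of derivative, and for `c ≠ 0` it recovers one more derivative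
(`derivSum_le_shift`). This compares `‖LL g‖` with the sum of the norms of all derivatives, and
interpolation (`exists_derivSum_le`) reduces that sum to its two extreme terms. -/

noncomputable section

namespace SobolevLine

set_option linter.unusedSectionVars false

variable {p : ℝ} [Fact (1 < p)]

/-! ### Translations in `L^p` and the first order lower bound -/

/-- The translate `s ↦ g (t + s)` of an `L^p` function. -/
def translate (g : LpLine p) (t : ℝ) : LpLine p :=
  Lp.compMeasurePreserving (fun x => t + x) (measurePreserving_add_left volume t) g

theorem coeFn_translate (g : LpLine p) (t : ℝ) : translate g t =ᵐ[volume] fun x => g (t + x) :=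
  Lp.coeFn_compMeasurePreserving g (measurePreserving_add_left volume t)

theorem norm_translate (g : LpLine p) (t : ℝ) : ‖translate g t‖ = ‖g‖ :=
  Lp.norm_compMeasurePreserving g (measurePreserving_add_left volume t)

theorem translate_zero (g : LpLine p) : translate g 0 = g := by
  apply Lp.ext
  filter_upwards [coeFn_translate g 0] with x hx
  rw [hx, zero_add]

theorem continuous_translate (g : LpLine p) : Continuous (translate g) := by
  have : Fact (ENNReal.ofReal p ≠ ⊤) := ⟨ENNReal.ofReal_ne_top⟩
  have h : Continuous fun t : ℝ => DomAddAct.mk t +ᵥ g :=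
    Continuous.vadd DomAddAct.continuous_mk continuous_const
  exact h

/-- Integration against a test function, as a continuous functional on `L^p`. -/
theorem exists_testFunctional {φ : ℝ → ℝ} (hφ : ContDiff ℝ ∞ φ) (hc : HasCompactSupport φ) :
    ∃ ℓ : LpLine p →L[ℝ] ℝ, ∀ g, ℓ g = ∫ s, g s * φ s := by
  have hp : Fact (1 ≤ ENNReal.ofReal p) := inferInstance
  have := ENNReal.HolderConjugate.inv_one_sub_inv' hp.out
  have : Fact (1 ≤ (1 - (ENNReal.ofReal p)⁻¹)⁻¹) := by simp [fact_iff]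
  have hm : MemLp φ (1 - (ENNReal.ofReal p)⁻¹)⁻¹ volume :=
    hφ.continuous.memLp_of_hasCompactSupport hc
  refine ⟨((ContinuousLinearMap.mul ℝ ℝ).lpPairing volume (ENNReal.ofReal p)
    (1 - (ENNReal.ofReal p)⁻¹)⁻¹).flip (hm.toLp φ), fun g => ?_⟩
  rw [ContinuousLinearMap.flip_apply, ContinuousLinearMap.lpPairing_eq_integral]
  refine integral_congr_ae ?_
  filter_upwards [hm.coeFn_toLp] with x hx
  rw [hx, ContinuousLinearMap.mul_apply']

theorem integral_translate_mul (g : LpLine p) (t : ℝ) (φ : ℝ → ℝ) :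
    ∫ x, translate g t x * φ x = ∫ x, g x * φ (x - t) := by
  have h : ∫ x, translate g t x * φ x = ∫ x, g (t + x) * φ x := by
    refine integral_congr_ae ?_
    filter_upwards [coeFn_translate g t] with x hx
    rw [hx]
  rw [h, ← integral_add_left_eq_self (fun x => g x * φ (x - t)) t]
  simp

/-- The pairing is the convolution of `g` with the reflected test function. The derivative falls on
the smooth kernel, and the definition of weak derivative moves it to `f`. -/
theorem HasWeakDeriv.hasDerivAt_integral_translate {g f : LpLine p} (h : HasWeakDeriv 1 g f)
    {φ : ℝ → ℝ} (hφ : ContDiff ℝ ∞ φ) (hc : HasCompactSupport φ) (t : ℝ) :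
    HasDerivAt (fun t => ∫ x, translate g t x * φ x) (∫ x, translate f t x * φ x) t := by
  have hc' : HasCompactSupport fun x => φ (-x) := hc.comp_homeomorph (Homeomorph.neg ℝ)
  have hφ' : ContDiff ℝ ∞ fun x => φ (-x) := hφ.comp contDiff_neg
  have key := hc'.hasDerivAt_convolution_right (ContinuousLinearMap.mul ℝ ℝ) (μ := volume)
    (locallyIntegrable_coe g) (hφ'.of_le (by simp)) t
  have e₁ : (fun t => ∫ x, translate g t x * φ x) =
      convolution g (fun x => φ (-x)) (ContinuousLinearMap.mul ℝ ℝ) volume := by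
    funext t
    rw [integral_translate_mul, convolution_def]
    simp
  have ht : ContDiff ℝ ∞ fun x => φ (x - t) := hφ.comp (contDiff_id.sub contDiff_const)
  have htc : HasCompactSupport fun x => φ (x - t) := by
    simpa [Function.comp_def, sub_eq_add_neg] using hc.comp_homeomorph (Homeomorph.addRight (-t))
  have e₂ : ∫ x, translate f t x * φ x =
      convolution g (deriv fun x => φ (-x)) (ContinuousLinearMap.mul ℝ ℝ) volume t := by
    have h' := h _ ht htc
    rw [integral_translate_mul, convolution_def]
    rw [pow_one, neg_one_mul, eq_comm, neg_eq_iff_eq_neg] at h'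
    rw [h', ← integral_neg]
    refine integral_congr_ae (Filter.Eventually.of_forall fun x => ?_)
    have d : deriv (fun x => φ (x - t)) x = deriv φ (x - t) := by
      rw [deriv_comp_sub_const]
    simp [deriv_comp_neg, d]
  rw [e₁, e₂]
  exact key

/-- Tested against `φ`, this is the scalar fundamental theorem of calculus; test functions separate
`L^p`. -/
theorem HasWeakDeriv.integral_translate {g f : LpLine p} (h : HasWeakDeriv 1 g f) (t : ℝ) :
    ∫ s in (0 : ℝ)..t, translate f s = translate g t - g := by
  apply Lp.ext
  refine ae_eq_of_integral_contDiff_smul_eq (locallyIntegrable_coe _)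
    (locallyIntegrable_coe _) fun φ hφ hc => ?_
  obtain ⟨ℓ, hℓ⟩ := exists_testFunctional (p := p) hφ hc
  simp only [smul_eq_mul, mul_comm (φ _)]
  rw [← hℓ, ← hℓ, map_sub]
  rw [← ContinuousLinearMap.intervalIntegral_comp_comm ℓ
    ((continuous_translate f).intervalIntegrable 0 t)]
  have hd : ∀ s ∈ Set.uIcc 0 t, HasDerivAt (fun s => ℓ (translate g s)) (ℓ (translate f s)) s := by
    intro s _
    simp only [hℓ]
    exact h.hasDerivAt_integral_translate hφ hc s
  rw [intervalIntegral.integral_eq_sub_of_hasDerivAt hd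
    ((ℓ.continuous.comp (continuous_translate f)).intervalIntegrable 0 t), translate_zero]

/-- Upgrades the weak derivative to a derivative in `L^p` norm: `translate f` is continuous, so its
Bochner integral is differentiable. -/
theorem HasWeakDeriv.hasDerivAt_translate {g f : LpLine p} (h : HasWeakDeriv 1 g f) :
    HasDerivAt (translate g) f 0 := by
  have hd := ((continuous_translate f).integral_hasStrictDerivAt 0 0).hasDerivAt
  simp only [h.integral_translate, translate_zero] at hd
  simpa using hd.add_const g

/-- The operator `g ↦ g' - c g` is bounded below by `|c|`. -/
theorem HasWeakDeriv.abs_mul_norm_le {g f : LpLine p} (h : HasWeakDeriv 1 g f) (c : ℝ) :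
    |c| * ‖g‖ ≤ ‖f - c • g‖ := by
  rcases eq_or_ne c 0 with rfl | hc
  · simp
  -- Moving at speed `c` lets `t > 0` serve for either sign of `c`.
  have hd : HasDerivAt (fun t : ℝ => translate g (c * t)) (c • f) 0 := by
    have h₁ : HasDerivAt (fun t : ℝ => c * t) c 0 := by simpa using (hasDerivAt_id (0 : ℝ)).const_mul c
    have h₂ : HasDerivAt (translate g) f (c * 0) := by simpa using h.hasDerivAt_translate
    exact h₂.scomp 0 h₁
  have hlim := (hasDerivAt_iff_tendsto_slope_zero.1 hd).mono_left
    (nhdsWithin_mono 0 fun x (hx : x ∈ Set.Ioi (0 : ℝ)) => ne_of_gt hx)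
  have hlim' := (hlim.sub_const (c ^ 2 • g)).norm
  have hge : c ^ 2 * ‖g‖ ≤ ‖c • f - c ^ 2 • g‖ := by
    refine ge_of_tendsto hlim' ?_
    filter_upwards [self_mem_nhdsWithin] with t (ht : 0 < t)
    have e : t⁻¹ • (translate g (c * (0 + t)) - translate g (c * 0)) - c ^ 2 • g
        = t⁻¹ • (translate g (c * t) - (1 + t * c ^ 2) • g) := by
      rw [mul_zero, zero_add, translate_zero, add_smul, one_smul, ← sub_sub, smul_sub t⁻¹ _ (_ • g),
        smul_smul, inv_mul_cancel_left₀ ht.ne']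
    rw [e, norm_smul, norm_inv, Real.norm_of_nonneg ht.le]
    -- Translation is isometric, so the difference has norm at least `(1 + t c²) ‖g‖ - ‖g‖ = t c²
    -- ‖g‖`, which survives division by `t`.
    have h₃ := norm_sub_norm_le ((1 + t * c ^ 2) • g) (translate g (c * t))
    rw [norm_smul, norm_translate, Real.norm_of_nonneg (by positivity), norm_sub_rev] at h₃
    rw [inv_mul_eq_div, le_div_iff₀ ht]
    linarith
  have e : c • f - c ^ 2 • g = c • (f - c • g) := by rw [smul_sub, smul_smul, sq]
  rw [e, norm_smul, Real.norm_eq_abs, ← sq_abs, sq, mul_assoc] at hge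
  exact le_of_mul_le_mul_left hge (abs_pos.2 hc)

/-! ### Factorization into first order operators -/

theorem hasWeakDeriv_D (k : ℕ) (g : W p (k + 1)) :
    HasWeakDeriv 1 (g : LpLine p) (D k g : LpLine p) :=
  hasWeakDeriv_weakDeriv 1 (Nat.le_add_left 1 k) g

theorem D_eq_of_hasWeakDeriv {k : ℕ} {g : W p (k + 1)} {f : W p k}
    (h : HasWeakDeriv 1 (g : LpLine p) (f : LpLine p)) : D k g = f :=
  Subtype.ext ((hasWeakDeriv_D k g).unique h)

theorem D_incl (k : ℕ) (g : W p (k + 2)) : D k (incl (k + 1) g) = incl k (D (k + 1) g) :=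
  D_eq_of_hasWeakDeriv (hasWeakDeriv_D (k + 1) g)

theorem norm_incl (k : ℕ) (g : W p (k + 1)) : ‖incl k g‖ = ‖g‖ := rfl

/-- The first order operator `g ↦ g' - c g`. -/
def shift (c : ℝ) (k : ℕ) : W p (k + 1) →ₗ[ℝ] W p k :=
  D (p := p) k - c • incl (p := p) k

theorem shift_apply (c : ℝ) (k : ℕ) (g : W p (k + 1)) :
    shift c k g = D k g - c • incl k g := rfl

theorem L_apply (A γ : ℝ) (k : ℕ) (g : W p (k + 2)) :
    L A γ k g = D k (D (k + 1) g) - (2 * A) • incl k (D (k + 1) g)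
      - γ • incl k (incl (k + 1) g) := rfl

theorem D_shift (c : ℝ) (k : ℕ) (g : W p (k + 2)) :
    D k (shift c (k + 1) g) = shift c k (D (k + 1) g) := by
  rw [shift_apply, map_sub, map_smul, D_incl, shift_apply]

theorem abs_mul_norm_le_norm_shift (c : ℝ) (k : ℕ) (g : W p (k + 1)) :
    |c| * ‖g‖ ≤ ‖shift c k g‖ :=
  (hasWeakDeriv_D k g).abs_mul_norm_le c

theorem shift_shift (a b : ℝ) (k : ℕ) (g : W p (k + 2)) :
    shift a k (shift b (k + 1) g) = D k (D (k + 1) g) - (a + b) • incl k (D (k + 1) g)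
      + (a * b) • incl k (incl (k + 1) g) := by
  simp only [shift_apply, map_sub, map_smul, D_incl]
  module

/-- `L A γ` is a product of two real first order operators. -/
theorem exists_L_eq_shift_shift {A γ : ℝ} (h : 0 ≤ A ^ 2 + γ) :
    ∃ a b : ℝ, a * b = -γ ∧
      ∀ (k : ℕ) (g : W p (k + 2)), L A γ k g = shift a k (shift b (k + 1) g) := by
  have hs := Real.sq_sqrt h
  have hab : (A + √(A ^ 2 + γ)) * (A - √(A ^ 2 + γ)) = -γ := by linear_combination -hs
  refine ⟨A + √(A ^ 2 + γ), A - √(A ^ 2 + γ), hab, fun k g => ?_⟩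
  rw [shift_shift, hab, L_apply]
  module

theorem abs_mul_norm_le_norm_L {A γ : ℝ} (h : 0 ≤ A ^ 2 + γ) (k : ℕ) (g : W p (k + 2)) :
    |γ| * ‖g‖ ≤ ‖L A γ k g‖ := by
  obtain ⟨a, b, hab, hL⟩ := exists_L_eq_shift_shift (p := p) h
  rw [hL, ← abs_neg γ, ← hab, abs_mul, mul_assoc]
  exact (mul_le_mul_of_nonneg_left (abs_mul_norm_le_norm_shift b _ g) (abs_nonneg a)).trans
    (abs_mul_norm_le_norm_shift a k _)

theorem LL_succ_apply (m : ℕ) (A γ : Fin (m + 1) → ℝ) (g : W p (2 * m + 2)) :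
    LL (m + 1) A γ g = LL m (fun h => A h.castSucc) (fun h => γ h.castSucc)
      (L (A (Fin.last m)) (γ (Fin.last m)) (2 * m) g) := rfl

theorem prod_abs_mul_norm_le_norm_LL (m : ℕ) (A γ : Fin m → ℝ)
    (h : ∀ i, 0 ≤ A i ^ 2 + γ i) (g : W p (2 * m)) :
    (∏ i, |γ i|) * ‖g‖ ≤ ‖LL m A γ g‖ := by
  induction m with
  | zero => simp [LL]
  | succ m ih =>
    rw [Fin.prod_univ_castSucc, mul_assoc, LL_succ_apply m A γ g]
    refine le_trans (mul_le_mul_of_nonneg_left (abs_mul_norm_le_norm_L (h (Fin.last m)) (2 * m) g)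
      (Finset.prod_nonneg fun i _ => abs_nonneg _)) ?_
    exact ih _ _ (fun i => h i.castSucc) _

/-! ### Comparison of `LL` with the sum of all derivatives -/

/-- The sum of the `L^p` norms of the weak derivatives of order `0, …, k`. -/
def derivSum : (k : ℕ) → Seminorm ℝ (W p k)
  | 0 => normSeminorm ℝ (W p 0)
  | k + 1 => normSeminorm ℝ (W p (k + 1)) + (derivSum k).comp (D k)

theorem derivSum_zero (g : W p 0) : derivSum 0 g = ‖g‖ := rfl

theorem derivSum_succ (k : ℕ) (g : W p (k + 1)) :
    derivSum (k + 1) g = ‖g‖ + derivSum k (D k g) := rfl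

theorem norm_le_derivSum (k : ℕ) (g : W p k) : ‖g‖ ≤ derivSum k g := by
  cases k with
  | zero => exact le_rfl
  | succ k => exact le_add_of_nonneg_right (apply_nonneg _ _)

theorem derivSum_D_le (k : ℕ) (g : W p (k + 1)) : derivSum k (D k g) ≤ derivSum (k + 1) g :=
  le_add_of_nonneg_left (norm_nonneg g)

theorem derivSum_incl_le (k : ℕ) (g : W p (k + 1)) :
    derivSum k (incl k g) ≤ derivSum (k + 1) g := by
  induction k with
  | zero => exact norm_le_derivSum 1 g
  | succ k ih =>
    rw [derivSum_succ, derivSum_succ (k + 1), D_incl, norm_incl]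
    exact add_le_add_right (ih _) _

/-- `shift` commutes with `D`, so the core estimate applies to each derivative separately. -/
theorem abs_mul_derivSum_incl_le (c : ℝ) (k : ℕ) (g : W p (k + 1)) :
    |c| * derivSum k (incl k g) ≤ derivSum k (shift c k g) := by
  induction k with
  | zero => exact abs_mul_norm_le_norm_shift c 0 g
  | succ k ih =>
    rw [derivSum_succ, derivSum_succ, D_incl, D_shift, norm_incl, mul_add]
    exact add_le_add (abs_mul_norm_le_norm_shift c _ g) (ih _)

/-- Writing `S` for the right-hand seminorm, `‖g‖ ≤ |c|⁻¹ S`, while `g' = shift g + c g` costs at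
most `2 S`. -/
theorem derivSum_le_shift {c : ℝ} (hc : c ≠ 0) (k : ℕ) (g : W p (k + 1)) :
    derivSum (k + 1) g ≤ (2 + |c|⁻¹) * derivSum k (shift c k g) := by
  have h₁ := abs_mul_derivSum_incl_le c k g
  have h₂ : ‖g‖ ≤ |c|⁻¹ * derivSum k (shift c k g) := by
    rw [← norm_incl, inv_mul_eq_div, le_div_iff₀' (abs_pos.2 hc)]
    exact (mul_le_mul_of_nonneg_left (norm_le_derivSum _ _) (abs_nonneg c)).trans h₁
  have h₃ : derivSum k (D k g) ≤ derivSum k (shift c k g) + |c| * derivSum k (incl k g) := by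
    have := map_add_le_add (derivSum (p := p) k) (shift c k g) (c • incl k g)
    rwa [map_smul_eq_mul, Real.norm_eq_abs, shift_apply, sub_add_cancel, ← shift_apply] at this
  rw [derivSum_succ]
  linarith

theorem exists_derivSum_le_L {A γ : ℝ} (h : 0 ≤ A ^ 2 + γ) (hγ : γ ≠ 0) (k : ℕ) :
    ∃ C : ℝ, 0 < C ∧ ∀ g : W p (k + 2), derivSum (k + 2) g ≤ C * derivSum k (L A γ k g) := by
  obtain ⟨a, b, hab, hL⟩ := exists_L_eq_shift_shift (p := p) h
  have hab' : a * b ≠ 0 := by rwa [hab, neg_ne_zero]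
  refine ⟨(2 + |b|⁻¹) * (2 + |a|⁻¹), by positivity, fun g => ?_⟩
  rw [hL, mul_assoc]
  exact (derivSum_le_shift (right_ne_zero_of_mul hab') _ g).trans
    (mul_le_mul_of_nonneg_left (derivSum_le_shift (left_ne_zero_of_mul hab') _ _) (by positivity))

theorem exists_derivSum_le_LL (m : ℕ) (A γ : Fin m → ℝ) (h : ∀ i, 0 ≤ A i ^ 2 + γ i)
    (hγ : ∀ i, γ i ≠ 0) :
    ∃ C : ℝ, 0 < C ∧ ∀ g : W p (2 * m), derivSum (2 * m) g ≤ C * ‖LL m A γ g‖ := by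
  induction m with
  | zero => exact ⟨1, one_pos, fun g => (one_mul ‖g‖).ge⟩
  | succ m ih =>
    obtain ⟨C, hC, ih⟩ := ih _ _ (fun i => h i.castSucc) fun i => hγ i.castSucc
    obtain ⟨K, hK, hL⟩ := exists_derivSum_le_L (p := p) (h (Fin.last m)) (hγ (Fin.last m)) (2 * m)
    refine ⟨K * C, mul_pos hK hC, fun g => ?_⟩
    rw [mul_assoc]
    exact (hL g).trans (mul_le_mul_of_nonneg_left (ih _) hK.le)

theorem derivSum_L_le (A γ : ℝ) (k : ℕ) (g : W p (k + 2)) :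
    derivSum k (L A γ k g) ≤ (1 + 2 * |A| + |γ|) * derivSum (k + 2) g := by
  have h₁ := (derivSum_D_le k (D (k + 1) g)).trans (derivSum_D_le (k + 1) g)
  have h₂ := mul_le_mul_of_nonneg_left ((derivSum_incl_le k (D (k + 1) g)).trans
    (derivSum_D_le (k + 1) g)) (abs_nonneg (2 * A))
  have h₃ := mul_le_mul_of_nonneg_left ((derivSum_incl_le k (incl (k + 1) g)).trans
    (derivSum_incl_le (k + 1) g)) (abs_nonneg γ)
  have h₄ := map_sub_le_add (derivSum (p := p) k)
    (D k (D (k + 1) g) - (2 * A) • incl k (D (k + 1) g)) (γ • incl k (incl (k + 1) g))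
  have h₅ := map_sub_le_add (derivSum (p := p) k)
    (D k (D (k + 1) g)) ((2 * A) • incl k (D (k + 1) g))
  rw [map_smul_eq_mul, Real.norm_eq_abs] at h₄ h₅
  rw [abs_mul, abs_two] at h₂ h₅
  rw [L_apply]
  linarith

theorem exists_norm_LL_le (m : ℕ) (A γ : Fin m → ℝ) :
    ∃ C : ℝ, 0 < C ∧ ∀ g : W p (2 * m), ‖LL m A γ g‖ ≤ C * derivSum (2 * m) g := by
  induction m with
  | zero => exact ⟨1, one_pos, fun g => (one_mul ‖g‖).ge⟩
  | succ m ih =>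
    obtain ⟨C, hC, ih⟩ := ih (fun i => A i.castSucc) fun i => γ i.castSucc
    refine ⟨C * (1 + 2 * |A (Fin.last m)| + |γ (Fin.last m)|), by positivity, fun g => ?_⟩
    rw [mul_assoc]
    exact (ih _).trans (mul_le_mul_of_nonneg_left (derivSum_L_le _ _ _ g) hC.le)

/-! ### The zeroth order part of `LL` -/

theorem L_incl (A γ : ℝ) (k : ℕ) (g : W p (k + 3)) :
    L A γ k (incl (k + 2) g) = incl k (L A γ (k + 1) g) := by
  simp only [L_apply, map_sub, map_smul, D_incl]

theorem D_L (A γ : ℝ) (k : ℕ) (g : W p (k + 3)) :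
    D k (L A γ (k + 1) g) = L A γ k (D (k + 2) g) := by
  simp only [L_apply, map_sub, map_smul, D_incl]

theorem norm_L_add_le (A γ : ℝ) (k : ℕ) (g : W p (k + 2)) :
    ‖((L A γ k g : W p k) : LpLine p) + γ • (g : LpLine p)‖
      ≤ (1 + 2 * |A|) * derivSum (k + 1) (D (k + 1) g) := by
  have e : ((L A γ k g : W p k) : LpLine p) + γ • (g : LpLine p)
      = ((D k (D (k + 1) g) : W p k) : LpLine p)
        - (2 * A) • ((D (k + 1) g : W p (k + 1)) : LpLine p) := by
    rw [L_apply, Submodule.coe_sub, Submodule.coe_sub, Submodule.coe_smul, Submodule.coe_smul]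
    exact sub_add_cancel _ (γ • (g : LpLine p))
  have h₁ := (norm_le_derivSum k (D k (D (k + 1) g))).trans (derivSum_D_le k _)
  have h₂ := norm_le_derivSum (k + 1) (D (k + 1) g)
  rw [← Submodule.norm_coe] at h₁ h₂
  have h₃ := norm_sub_le ((D k (D (k + 1) g) : W p k) : LpLine p)
    ((2 * A) • ((D (k + 1) g : W p (k + 1)) : LpLine p))
  rw [norm_smul, Real.norm_eq_abs, abs_mul, abs_two] at h₃
  have h₄ := mul_le_mul_of_nonneg_left h₂ (by positivity : 0 ≤ 2 * |A|)
  rw [e]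
  linarith

/-- Up to terms containing a derivative, the operator `LL` is multiplication by `∏ (-γ_h)`. -/
theorem exists_norm_LL_sub_le (m : ℕ) (A γ : Fin m → ℝ) :
    ∃ C : ℝ, 0 < C ∧ ∀ g : W p (2 * m + 1),
      ‖(LL m A γ (incl _ g) : LpLine p) - (∏ i, -γ i) • (g : LpLine p)‖
        ≤ C * derivSum (2 * m) (D _ g) := by
  induction m with
  | zero =>
    refine ⟨1, one_pos, fun g => ?_⟩
    have h : (LL 0 A γ (incl _ g) : LpLine p) = g := rfl
    rw [h]
    simp
  | succ m ih =>
    obtain ⟨C, hC, ih⟩ := ih (fun i => A i.castSucc) fun i => γ i.castSucc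
    set a := A (Fin.last m) with ha
    set c := γ (Fin.last m) with hc
    set P := ∏ i : Fin m, -γ i.castSucc with hP
    refine ⟨C * (1 + 2 * |a| + |c|) + |P| * (1 + 2 * |a|), by positivity, fun g => ?_⟩
    change W p (2 * m + 3) at g
    change ‖(LL m (fun i => A i.castSucc) (fun i => γ i.castSucc)
      (L a c (2 * m) (incl (2 * m + 2) g)) : LpLine p) - (∏ i, -γ i) • (g : LpLine p)‖
        ≤ _ * derivSum (2 * m + 2) (D (2 * m + 2) g)
    have h₁ := ih (L a c (2 * m + 1) g)
    rw [← L_incl, D_L] at h₁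
    have h₂ := derivSum_L_le a c (2 * m) (D (2 * m + 2) g)
    have h₄ := norm_L_add_le a c (2 * m + 1) g
    rw [Fin.prod_univ_castSucc, ← hP, ← hc]
    set X := (LL m (fun i => A i.castSucc) (fun i => γ i.castSucc)
      (L a c (2 * m) (incl (2 * m + 2) g)) : LpLine p)
    -- The induction hypothesis for `L g` bounds the first summand, `norm_L_add_le` the second. One
    -- derivative beyond `2m + 2` is available so that `D g` still lies in the domain of `derivSum`.
    have h₅ : X - (P * -c) • (g : LpLine p)
        = (X - P • ((L a c (2 * m + 1) g : W p (2 * m + 1)) : LpLine p))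
          + P • (((L a c (2 * m + 1) g : W p (2 * m + 1)) : LpLine p) + c • (g : LpLine p)) := by
      module
    rw [h₅]
    refine (norm_add_le _ _).trans ?_
    rw [norm_smul, Real.norm_eq_abs, add_mul, mul_assoc, mul_assoc]
    exact add_le_add (h₁.trans (mul_le_mul_of_nonneg_left h₂ hC.le))
      (mul_le_mul_of_nonneg_left h₄ (abs_nonneg P))

/-! ### Interpolation of intermediate derivatives -/

/-- Interpolation of the first derivative between the function and its second derivative. -/
theorem norm_D_le {c : ℝ} (hc : 0 < c) (k : ℕ) (g : W p (k + 2)) :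
    ‖D (k + 1) g‖ ≤ c * ‖D k (D (k + 1) g)‖ + 2 * c⁻¹ * ‖g‖ := by
  -- Opposite shifts cancel the first order term: `(D - c⁻¹)(D + c⁻¹) g = g'' - c⁻² g`.
  have h₁ := abs_mul_norm_le_norm_shift c⁻¹ k (shift (-c⁻¹) (k + 1) g)
  have h₂ : shift c⁻¹ k (shift (-c⁻¹) (k + 1) g)
      = D k (D (k + 1) g) - (c⁻¹ * c⁻¹) • incl k (incl (k + 1) g) := by
    rw [shift_shift]
    module
  have h₃ : ‖shift c⁻¹ k (shift (-c⁻¹) (k + 1) g)‖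
      ≤ ‖D k (D (k + 1) g)‖ + c⁻¹ * c⁻¹ * ‖g‖ := by
    rw [h₂]
    refine (norm_sub_le _ _).trans ?_
    rw [norm_smul, Real.norm_of_nonneg (by positivity), norm_incl, norm_incl]
  have h₄ : ‖D (k + 1) g‖ ≤ ‖shift (-c⁻¹) (k + 1) g‖ + c⁻¹ * ‖g‖ := by
    have h := norm_sub_le (shift (-c⁻¹) (k + 1) g) (c⁻¹ • incl (k + 1) g)
    have e : shift (-c⁻¹) (k + 1) g - c⁻¹ • incl (k + 1) g = D (k + 1) g := by
      rw [shift_apply]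
      module
    rwa [e, norm_smul, Real.norm_of_nonneg (by positivity), norm_incl] at h
  rw [abs_of_pos (by positivity)] at h₁
  have h₅ := mul_le_mul_of_nonneg_left (h₁.trans h₃) hc.le
  rw [mul_inv_cancel_left₀ hc.ne', mul_add, ← mul_assoc, mul_inv_cancel_left₀ hc.ne'] at h₅
  linarith

/-- The weak derivative of order `k` on `W^{k,p}(ℝ)`, by iteration of the first derivative. -/
def topDeriv : (k : ℕ) → W p k →ₗ[ℝ] LpLine p
  | 0 => (W p 0).subtype
  | k + 1 => topDeriv k ∘ₗ D k

theorem topDeriv_succ (k : ℕ) (g : W p (k + 1)) : topDeriv (k + 1) g = topDeriv k (D k g) := rfl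

theorem HasWeakDeriv.succ {j : ℕ} {g f h : LpLine p} (h₁ : HasWeakDeriv 1 g f)
    (h₂ : HasWeakDeriv j f h) : HasWeakDeriv (j + 1) g h := by
  intro φ hφ hc
  have a := h₁ _ (contDiff_iteratedDeriv hφ j) (hasCompactSupport_iteratedDeriv hc j)
  rw [iteratedDeriv_one, ← iteratedDeriv_succ, h₂ φ hφ hc] at a
  rw [a]
  ring

theorem hasWeakDeriv_topDeriv (k : ℕ) (g : W p k) :
    HasWeakDeriv k (g : LpLine p) (topDeriv k g) := by
  induction k with
  | zero => exact hasWeakDeriv_zero _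
  | succ k ih => exact (hasWeakDeriv_D k g).succ (ih _)

/-- Replaces the weak derivative picked by choice with a linear map. -/
theorem weakDeriv_self (k : ℕ) (g : W p k) : weakDeriv k le_rfl g = topDeriv k g :=
  (hasWeakDeriv_weakDeriv k le_rfl g).unique (hasWeakDeriv_topDeriv k g)

theorem norm_topDeriv_le (k : ℕ) (g : W p k) : ‖topDeriv k g‖ ≤ derivSum k g := by
  induction k with
  | zero => exact le_rfl
  | succ k ih => exact (ih _).trans (derivSum_D_le k g)

theorem exists_derivSum_le (k : ℕ) :
    ∃ C : ℝ, 0 < C ∧ ∀ g : W p k, derivSum k g ≤ C * (‖topDeriv k g‖ + ‖g‖) := by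
  induction k with
  | zero =>
    refine ⟨1, one_pos, fun g => ?_⟩
    rw [one_mul, derivSum_zero]
    exact le_add_of_nonneg_left (norm_nonneg _)
  | succ k ih =>
    obtain ⟨C, hC, ih⟩ := ih
    cases k with
    | zero =>
      refine ⟨1, one_pos, fun g => ?_⟩
      rw [one_mul, derivSum_succ, add_comm]
      rfl
    | succ k =>
      refine ⟨2 * (1 + C + 4 * C ^ 2), by positivity, fun g => ?_⟩
      have h₁ := ih (D (k + 1) g)
      -- With parameter `(2 * C)⁻¹` the second derivative enters with coefficient `1/2` and is
      -- absorbed by the left-hand side.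
      have h₂ := mul_le_mul_of_nonneg_left (norm_D_le (c := (2 * C)⁻¹) (by positivity) k g) hC.le
      have h₃ : ‖D k (D (k + 1) g)‖ ≤ derivSum (k + 2) g :=
        (norm_le_derivSum k _).trans ((derivSum_D_le k _).trans (derivSum_D_le (k + 1) g))
      have e : C * ((2 * C)⁻¹ * ‖D k (D (k + 1) g)‖ + 2 * (2 * C)⁻¹⁻¹ * ‖g‖)
          = ‖D k (D (k + 1) g)‖ / 2 + 4 * C ^ 2 * ‖g‖ := by
        field_simp
        ring
      rw [e] at h₂
      have h₄ : 0 ≤ (1 + 4 * C ^ 2) * ‖topDeriv (k + 2) g‖ := by positivity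
      have h₅ : 0 ≤ C * ‖g‖ := by positivity
      rw [← topDeriv_succ] at h₁
      have h₆ := derivSum_succ (k + 1) g
      linarith

theorem norm_rpow_eq_integral (f : LpLine p) : ‖f‖ ^ p = ∫ s, |f s| ^ p := by
  have hp : 0 < p := zero_lt_one.trans Fact.out
  have h0 : 0 ≤ ∫ s, ‖f s‖ ^ p :=
    integral_nonneg fun s => Real.rpow_nonneg (norm_nonneg _) p
  have h := (Lp.memLp f).eLpNorm_eq_integral_rpow_norm (ENNReal.ofReal_pos.2 hp).ne'
    ENNReal.ofReal_ne_top
  rw [ENNReal.toReal_ofReal hp.le] at h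
  rw [Lp.norm_def, h, ENNReal.toReal_ofReal (Real.rpow_nonneg h0 _), ← Real.rpow_mul h0,
    inv_mul_cancel₀ hp.ne', Real.rpow_one]
  rfl

/-! ### Dilated test functions -/

/-- The class in `L^p(ℝ)` of a test function. -/
def testLp {φ : ℝ → ℝ} (hφ : ContDiff ℝ ∞ φ) (hc : HasCompactSupport φ) : LpLine p :=
  (hφ.continuous.memLp_of_hasCompactSupport hc).toLp φ

theorem coeFn_testLp {φ : ℝ → ℝ} (hφ : ContDiff ℝ ∞ φ) (hc : HasCompactSupport φ) :
    (testLp hφ hc : LpLine p) =ᵐ[volume] φ :=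
  MemLp.coeFn_toLp _

theorem contDiff_deriv {φ : ℝ → ℝ} (hφ : ContDiff ℝ ∞ φ) : ContDiff ℝ ∞ (deriv φ) := by
  simpa using contDiff_iteratedDeriv hφ 1

theorem hasWeakDeriv_one_testLp {φ : ℝ → ℝ} (hφ : ContDiff ℝ ∞ φ) (hc : HasCompactSupport φ) :
    HasWeakDeriv 1 (testLp hφ hc : LpLine p) (testLp (contDiff_deriv hφ) hc.deriv) := by
  intro ψ hψ hψc
  have e₁ : ∫ s, (testLp hφ hc : LpLine p) s * iteratedDeriv 1 ψ s = ∫ s, φ s * deriv ψ s := by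
    refine integral_congr_ae ?_
    filter_upwards [coeFn_testLp (p := p) hφ hc] with s hs
    rw [hs, iteratedDeriv_one]
  have e₂ : ∫ s, (testLp (contDiff_deriv hφ) hc.deriv : LpLine p) s * ψ s
      = ∫ s, deriv φ s * ψ s := by
    refine integral_congr_ae ?_
    filter_upwards [coeFn_testLp (p := p) (contDiff_deriv hφ) hc.deriv] with s hs
    rw [hs]
  rw [e₁, e₂, pow_one, neg_one_mul]
  have c₁ := (contDiff_deriv hφ).continuous
  have c₂ := (contDiff_deriv hψ).continuous
  refine integral_mul_deriv_eq_deriv_mul_of_integrable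
    (fun x _ => (hφ.differentiable (by simp) x).hasDerivAt)
    (fun x _ => (hψ.differentiable (by simp) x).hasDerivAt) ?_ ?_ ?_
  · exact (hφ.continuous.mul c₂).integrable_of_hasCompactSupport hc.mul_right
  · exact (c₁.mul hψ.continuous).integrable_of_hasCompactSupport hψc.mul_left
  · exact (hφ.continuous.mul hψ.continuous).integrable_of_hasCompactSupport hc.mul_right

theorem exists_hasWeakDeriv_testLp {φ : ℝ → ℝ} (hφ : ContDiff ℝ ∞ φ) (hc : HasCompactSupport φ)
    (j : ℕ) : ∃ f : LpLine p, HasWeakDeriv j (testLp hφ hc) f := by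
  induction j generalizing φ with
  | zero => exact ⟨_, hasWeakDeriv_zero _⟩
  | succ j ih =>
    obtain ⟨f, hf⟩ := ih (contDiff_deriv hφ) hc.deriv
    exact ⟨f, (hasWeakDeriv_one_testLp hφ hc).succ hf⟩

/-- A test function as an element of `W^{k,p}(ℝ)`. -/
def testW (k : ℕ) {φ : ℝ → ℝ} (hφ : ContDiff ℝ ∞ φ) (hc : HasCompactSupport φ) : W p k :=
  ⟨testLp hφ hc, fun j _ => exists_hasWeakDeriv_testLp hφ hc j⟩

theorem D_testW (k : ℕ) {φ : ℝ → ℝ} (hφ : ContDiff ℝ ∞ φ) (hc : HasCompactSupport φ) :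
    D k (testW (k + 1) hφ hc : W p (k + 1)) = testW k (contDiff_deriv hφ) hc.deriv :=
  D_eq_of_hasWeakDeriv (hasWeakDeriv_one_testLp hφ hc)

theorem contDiff_dilate {φ : ℝ → ℝ} (hφ : ContDiff ℝ ∞ φ) (ε : ℝ) :
    ContDiff ℝ ∞ fun s => φ (ε * s) :=
  hφ.comp (contDiff_const.mul contDiff_id)

theorem hasCompactSupport_dilate {φ : ℝ → ℝ} (hc : HasCompactSupport φ) {ε : ℝ} (hε : 0 < ε) :
    HasCompactSupport fun s => φ (ε * s) :=
  hc.comp_homeomorph (Homeomorph.mulLeft₀ ε hε.ne')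

theorem D_testW_dilate (k : ℕ) {φ : ℝ → ℝ} (hφ : ContDiff ℝ ∞ φ) (hc : HasCompactSupport φ)
    {ε : ℝ} (hε : 0 < ε) :
    D k (testW (k + 1) (contDiff_dilate hφ ε) (hasCompactSupport_dilate hc hε) : W p (k + 1)) =
      ε • testW k (contDiff_dilate (contDiff_deriv hφ) ε) (hasCompactSupport_dilate hc.deriv hε) := by
  rw [D_testW]
  refine Subtype.ext (Lp.ext ?_)
  filter_upwards [coeFn_testLp (p := p) (contDiff_deriv (contDiff_dilate hφ ε))
      (hasCompactSupport_dilate hc hε).deriv,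
    coeFn_testLp (p := p) (contDiff_dilate (contDiff_deriv hφ) ε)
      (hasCompactSupport_dilate hc.deriv hε),
    Lp.coeFn_smul ε (testLp (contDiff_dilate (contDiff_deriv hφ) ε)
      (hasCompactSupport_dilate hc.deriv hε) : LpLine p)] with s h₁ h₂ h₃
  refine h₁.trans (Eq.trans ?_ h₃.symm)
  rw [Pi.smul_apply, h₂, deriv_comp_mul_left ε φ s]

theorem norm_testLp_dilate {φ : ℝ → ℝ} (hφ : ContDiff ℝ ∞ φ) (hc : HasCompactSupport φ)
    {ε : ℝ} (hε : 0 < ε) :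
    ‖(testLp (contDiff_dilate hφ ε) (hasCompactSupport_dilate hc hε) : LpLine p)‖
      = ε⁻¹ ^ (1 / p) * ‖(testLp hφ hc : LpLine p)‖ := by
  have hp : 0 < p := zero_lt_one.trans Fact.out
  have hρ : 0 ≤ ε⁻¹ ^ (1 / p) := by positivity
  rw [← Real.rpow_left_inj (norm_nonneg _) (mul_nonneg hρ (norm_nonneg _)) hp.ne',
    Real.mul_rpow hρ (norm_nonneg _), norm_rpow_eq_integral, norm_rpow_eq_integral,
    ← Real.rpow_mul (by positivity), one_div_mul_cancel hp.ne', Real.rpow_one]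
  have e₁ : ∫ s, |(testLp (contDiff_dilate hφ ε) (hasCompactSupport_dilate hc hε) : LpLine p) s| ^ p
      = ∫ s, |φ (ε * s)| ^ p := by
    refine integral_congr_ae ?_
    filter_upwards [coeFn_testLp (p := p) (contDiff_dilate hφ ε)
      (hasCompactSupport_dilate hc hε)] with s hs
    rw [hs]
  have e₂ : ∫ s, |(testLp hφ hc : LpLine p) s| ^ p = ∫ s, |φ s| ^ p := by
    refine integral_congr_ae ?_
    filter_upwards [coeFn_testLp (p := p) hφ hc] with s hs
    rw [hs]
  rw [e₁, e₂, Measure.integral_comp_mul_left (fun s => |φ s| ^ p) ε, abs_of_pos (inv_pos.2 hε),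
    smul_eq_mul]

/-- All orders share the factor `ε ^ (-1/p)`; the further powers of `ε` are dropped using `ε ≤ 1`.
-/
theorem derivSum_testW_dilate_le (k : ℕ) {φ : ℝ → ℝ} (hφ : ContDiff ℝ ∞ φ)
    (hc : HasCompactSupport φ) {ε : ℝ} (hε : 0 < ε) (hε₁ : ε ≤ 1) :
    derivSum k (testW k (contDiff_dilate hφ ε) (hasCompactSupport_dilate hc hε) : W p k)
      ≤ ε⁻¹ ^ (1 / p) * derivSum k (testW k hφ hc : W p k) := by
  induction k generalizing φ with
  | zero => exact (norm_testLp_dilate hφ hc hε).le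
  | succ k ih =>
    rw [derivSum_succ, derivSum_succ, D_testW_dilate k hφ hc hε, D_testW, mul_add, map_smul_eq_mul,
      Real.norm_of_nonneg hε.le]
    refine add_le_add (norm_testLp_dilate hφ hc hε).le ?_
    exact (mul_le_of_le_one_left (apply_nonneg _ _) hε₁).trans (ih _ _)

theorem exists_testLp_ne_zero :
    ∃ (φ : ℝ → ℝ) (hφ : ContDiff ℝ ∞ φ) (hc : HasCompactSupport φ),
      0 < ‖(testLp hφ hc : LpLine p)‖ := by
  let B : ContDiffBump (0 : ℝ) := default
  refine ⟨B, B.contDiff, B.hasCompactSupport, norm_pos_iff.2 fun h => ?_⟩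
  have h₁ := coeFn_testLp (p := p) B.contDiff B.hasCompactSupport
  rw [h] at h₁
  have h₂ := h₁.symm.trans (Lp.coeFn_zero ℝ (ENNReal.ofReal p) (volume : Measure ℝ))
  have h₃ := (Continuous.ae_eq_iff_eq volume B.continuous (continuous_const (y := (0 : ℝ)))).1 h₂
  have h₄ : B 0 = 1 := B.one_of_mem_closedBall (by simp [B.rIn_pos.le])
  have h₅ := congr_fun h₃ 0
  simp [h₄] at h₅

/-- Dilated test functions almost attain the factor `∏ |γ_h|`. -/
theorem exists_norm_LL_testW_le (m : ℕ) (A γ : Fin m → ℝ) :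
    ∃ C : ℝ, ∀ ε : ℝ, 0 < ε → ε ≤ 1 → ∃ g : W p (2 * m), 0 < ‖g‖ ∧
      ‖LL m A γ g‖ ≤ (∏ i, |γ i| + ε * C) * ‖g‖ := by
  obtain ⟨C, hC, h⟩ := exists_norm_LL_sub_le (p := p) m A γ
  obtain ⟨φ, hφ, hc, hpos⟩ := exists_testLp_ne_zero (p := p)
  set M := ‖(testLp hφ hc : LpLine p)‖ with hM
  set K := derivSum (2 * m) (testW (2 * m) (contDiff_deriv hφ) hc.deriv : W p (2 * m)) with hK
  refine ⟨C * K / M, fun ε hε hε₁ => ?_⟩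
  set g : W p (2 * m + 1) :=
    testW (2 * m + 1) (contDiff_dilate hφ ε) (hasCompactSupport_dilate hc hε) with hg
  have hn : ‖incl (2 * m) g‖ = ε⁻¹ ^ (1 / p) * M := norm_testLp_dilate hφ hc hε
  have hρ : 0 < ε⁻¹ ^ (1 / p) := by positivity
  -- The gain `ε` comes from the one derivative outside `derivSum`; the factor `ε⁻¹ ^ (1 / p)`
  -- cancels against `‖g‖`.
  have hD : derivSum (2 * m) (D (2 * m) g) ≤ ε * (ε⁻¹ ^ (1 / p) * K) := by
    rw [hg, D_testW_dilate (2 * m) hφ hc hε, map_smul_eq_mul, Real.norm_of_nonneg hε.le]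
    exact mul_le_mul_of_nonneg_left (derivSum_testW_dilate_le _ _ _ hε hε₁) hε.le
  refine ⟨incl (2 * m) g, by rw [hn]; positivity, ?_⟩
  have h₁ := (norm_le_norm_sub_add (LL m A γ (incl _ g) : LpLine p)
    ((∏ i, -γ i) • (g : LpLine p))).trans (add_le_add_left ((h g).trans
      (mul_le_mul_of_nonneg_left hD hC.le)) _)
  have e : ‖(∏ i, -γ i) • (g : LpLine p)‖ = (∏ i, |γ i|) * ‖incl (2 * m) g‖ := by
    rw [norm_smul, norm_prod]
    simp only [norm_neg, Real.norm_eq_abs]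
    rfl
  rw [e] at h₁
  refine h₁.trans (le_of_eq ?_)
  rw [hn]
  field_simp
  ring

/-! ### The infimum and the equivalence of norms -/

theorem integral_div_integral (f g : LpLine p) :
    (∫ s, |f s| ^ p) / ∫ s, |g s| ^ p = (‖f‖ / ‖g‖) ^ p := by
  rw [← norm_rpow_eq_integral, ← norm_rpow_eq_integral,
    Real.div_rpow (norm_nonneg _) (norm_nonneg _)]

theorem isGLB_quotient (m : ℕ) (A γ : Fin m → ℝ) (hAγ : ∀ h, 0 ≤ A h ^ 2 + γ h) :
    IsGLB {r : ℝ | ∃ g : W p (2 * m), g ≠ 0 ∧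
        r = (∫ s, |(LL m A γ g : LpLine p) s| ^ p) / ∫ s, |(g : LpLine p) s| ^ p}
      (∏ h, |γ h| ^ p) := by
  have hp : 0 < p := zero_lt_one.trans Fact.out
  have hP : 0 ≤ ∏ h, |γ h| := Finset.prod_nonneg fun i _ => abs_nonneg _
  rw [Real.finsetProd_rpow _ _ fun i _ => abs_nonneg _]
  constructor
  · rintro r ⟨g, hg, rfl⟩
    rw [integral_div_integral]
    refine Real.rpow_le_rpow hP ?_ hp.le
    rw [le_div_iff₀ (norm_pos_iff.2 fun h => hg (Subtype.ext h))]
    exact prod_abs_mul_norm_le_norm_LL m A γ hAγ g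
  · intro b hb
    obtain ⟨C, hC⟩ := exists_norm_LL_testW_le (p := p) m A γ
    -- Only almost minimizers are available, so a lower bound `b` is compared with the limit as `ε →
    -- 0+`.
    have hcont : Continuous fun ε : ℝ => (∏ i, |γ i| + ε * C) ^ p :=
      (continuous_const.add (continuous_id.mul continuous_const)).rpow_const fun _ => Or.inr hp.le
    have hlim : Filter.Tendsto (fun ε : ℝ => (∏ i, |γ i| + ε * C) ^ p)
        (nhdsWithin 0 (Set.Ioi 0)) (nhds ((∏ i, |γ i|) ^ p)) := by
      simpa using (hcont.tendsto 0).mono_left nhdsWithin_le_nhds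
    refine ge_of_tendsto hlim ?_
    filter_upwards [Ioc_mem_nhdsGT (zero_lt_one' ℝ)] with ε hε
    obtain ⟨g, hg, hle⟩ := hC ε hε.1 hε.2
    refine (hb ⟨g, norm_pos_iff.1 hg, rfl⟩).trans ?_
    rw [integral_div_integral]
    refine Real.rpow_le_rpow (div_nonneg (norm_nonneg _) (norm_nonneg _)) ?_ hp.le
    exact (div_le_iff₀ hg).2 hle

theorem sobolevNorm_eq {k : ℕ} (g : W p k) :
    sobolevNorm g = (‖topDeriv k g‖ ^ p + ‖g‖ ^ p) ^ (1 / p) := by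
  rw [sobolevNorm, weakDeriv_self, ← norm_rpow_eq_integral, ← norm_rpow_eq_integral]
  rfl

theorem sobolevNorm_le {k : ℕ} (g : W p k) : sobolevNorm g ≤ ‖topDeriv k g‖ + ‖g‖ := by
  have hp : 1 < p := Fact.out
  rw [sobolevNorm_eq]
  exact Real.rpow_add_rpow_le_add (norm_nonneg _) (norm_nonneg _) hp.le

theorem add_le_sobolevNorm {k : ℕ} (g : W p k) :
    ‖topDeriv k g‖ + ‖g‖ ≤ 2 * sobolevNorm g := by
  have hp : 0 < p := zero_lt_one.trans Fact.out
  have ha : 0 ≤ ‖topDeriv k g‖ ^ p := by positivity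
  have hb : 0 ≤ ‖g‖ ^ p := by positivity
  have h₁ : ‖topDeriv k g‖ ≤ sobolevNorm g := by
    rw [sobolevNorm_eq, one_div]
    exact (Real.le_rpow_inv_iff_of_pos (norm_nonneg _) (add_nonneg ha hb) hp).2 (by linarith)
  have h₂ : ‖g‖ ≤ sobolevNorm g := by
    rw [sobolevNorm_eq, one_div]
    exact (Real.le_rpow_inv_iff_of_pos (norm_nonneg _) (add_nonneg ha hb) hp).2 (by linarith)
  linarith

theorem exists_sobolevNorm_equivalent (m : ℕ) (A γ : Fin m → ℝ)
    (hAγ : ∀ h, 0 ≤ A h ^ 2 + γ h) (hγ : ∀ h, γ h ≠ 0) :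
    ∃ N : Seminorm ℝ (W p (2 * m)),
      (∀ g, N g = ‖(LL m A γ g : LpLine p)‖) ∧ (∀ g, N g = 0 → g = 0) ∧
      ∃ c C : ℝ, 0 < c ∧ 0 < C ∧ ∀ g, c * sobolevNorm g ≤ N g ∧ N g ≤ C * sobolevNorm g := by
  obtain ⟨K, hK, hlow⟩ := exists_derivSum_le_LL (p := p) m A γ hAγ hγ
  obtain ⟨C, hC, hup⟩ := exists_norm_LL_le (p := p) m A γ
  obtain ⟨C', hC', hint⟩ := exists_derivSum_le (p := p) (2 * m)
  -- Both factors `2` come from comparing the `ℓ^p` and `ℓ^1` combinations with their two terms: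
  -- `sobolevNorm ≤ 2 * derivSum`, and `‖topDeriv g‖ + ‖g‖ ≤ 2 * sobolevNorm`.
  refine ⟨(normSeminorm ℝ (W p 0)).comp (LL m A γ), fun g => rfl, fun g hg => ?_,
    (2 * K)⁻¹, C * (C' * 2), by positivity, by positivity, fun g => ⟨?_, ?_⟩⟩
  · have h₁ : ‖LL m A γ g‖ = 0 := hg
    have h₂ := (norm_le_derivSum _ g).trans (hlow g)
    rw [h₁, mul_zero] at h₂
    exact norm_le_zero_iff.1 h₂
  · change (2 * K)⁻¹ * sobolevNorm g ≤ ‖LL m A γ g‖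
    rw [inv_mul_le_iff₀ (by positivity)]
    have h₁ := norm_topDeriv_le _ g
    have h₂ := norm_le_derivSum _ g
    have h₃ := hlow g
    have h₄ := sobolevNorm_le g
    linarith
  · change ‖LL m A γ g‖ ≤ C * (C' * 2) * sobolevNorm g
    refine (hup g).trans ?_
    rw [mul_assoc, mul_assoc]
    exact mul_le_mul_of_nonneg_left ((hint g).trans
      (mul_le_mul_of_nonneg_left (add_le_sobolevNorm g) hC'.le)) hC.le

end SobolevLine

end

theorem proposition5p1 (p : ℝ) [Fact (1 < p)] (m : ℕ) (hm : 1 ≤ m) (A γ : Fin m → ℝ)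
    (hAγ : ∀ h, 0 ≤ A h ^ 2 + γ h) :
    IsGLB {r : ℝ | ∃ g : SobolevLine.W p (2 * m), g ≠ 0 ∧
        r = (∫ s, |(SobolevLine.LL m A γ g : SobolevLine.LpLine p) s| ^ p) /
          ∫ s, |(g : SobolevLine.LpLine p) s| ^ p}
      (∏ h, |γ h| ^ p) ∧
    ((∀ h, γ h ≠ 0) →
      ∃ N : Seminorm ℝ (SobolevLine.W p (2 * m)),
        (∀ g, N g = ‖(SobolevLine.LL m A γ g : SobolevLine.LpLine p)‖) ∧
        (∀ g, N g = 0 → g = 0) ∧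
        ∃ c C : ℝ, 0 < c ∧ 0 < C ∧ ∀ g,
          c * SobolevLine.sobolevNorm g ≤ N g ∧ N g ≤ C * SobolevLine.sobolevNorm g) := by
  exact ⟨SobolevLine.isGLB_quotient m A γ hAγ,
    SobolevLine.exists_sobolevNorm_equivalent m A γ hAγ⟩
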